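/- Let $K$ be a field that is complete with respect to a discrete valuation $v$ (written additively), with residue field $k$ of characteristic $p \ge 0$. Let $\overline{K}$ be an algebraic closure of $K$. Let $\ell \ge 2$ be an integer, and assume that either $p \nmid \ell$ (the tame case), or $\ell = p$ and $K$ is a finite extension of $\mathbb{Q}_p$ (the wild case). Let $c \in K^\times$, let $a \in K$, and let $f(z) = z^\ell - c \in K[z]$, with $n$-th iterate $f^n$. For an integer $n \ge 0$ let $f^{-n}(a)$ be the set of solutions of $f^n(z) = a$ in $\overline{K}$, let $K_n = K(f^{-n}(a)) \subseteq \overline{K}$, let $G(n) = \operatorname{Aut}(K_n/K)$, and let $I(n)$ be the inertia subgroup of $G(n)$, i.e. the subgroup of automorphisms acting trivially on the residue field of $K_n$ (with respect to the unique extension of $v$ to $K_n$). Suppose that $v(c) < -\frac{\ell}{\ell-1}\, v(\ell)$, that $v(a) > v(c)$ (where $v(0) = +\infty$), and that $K$ contains the group $\mu_\ell$ of all $\ell$-th roots of unity in $\overline{K}$. Then for every integer $n \ge 0$: (a) the group $G(n)$ is isomorphic to a subgroup of $(\mathbb{Z}/\ell\mathbb{Z})^n$; (b) the group $G(n)/I(n)$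 is cyclic of order dividing $\ell$; (c) for every $\alpha \in f^{-n}(a)$ we have $K_n = K(\alpha)$. -/

import Mathlib

open scoped Valued WithZero

noncomputable section

namespace LocalArboreal

open Polynomial

/-- The additive valuation of a nonzero element of a field with a `ℤᵐ⁰`-valued
(multiplicative) valuation: `ord x = m` means `Valued.v x = exp (-m)`.
It is only meaningful for `x ≠ 0` (the junk value at `0` is `0`). -/
def ord {K : Type*} [Field K] [Valued K ℤᵐ⁰] (x : K) : ℤ :=
  -WithZero.log (Valued.v x)

/-- The valued field `K` is a finite extension of `ℚ_p`
(with its topology compatible with that of `ℚ_p`). -/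
def IsFinitePadicExtension (p : ℕ) (K : Type*) [Field K] [Valued K ℤᵐ⁰] : Prop :=
  ∃ (_ : Fact p.Prime) (_ : Algebra ℚ_[p] K),
    Module.Finite ℚ_[p] K ∧ Continuous (algebraMap ℚ_[p] K)

/-- The polynomial `f(z) = z^ℓ - c`. -/
def poly {K : Type*} [Field K] (ℓ : ℕ) (c : K) : K[X] := X ^ ℓ - C c

/-- The set `f^{-n}(a)` of solutions `z ∈ Ω` to `f^n(z) = a`, where `f(z) = z^ℓ - c` and
`f^n` is the `n`-th iterate. -/
def preimages {K : Type*} [Field K] (Ω : Type*) [Field Ω] [Algebra K Ω]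
    (ℓ : ℕ) (c a : K) (n : ℕ) : Set Ω :=
  {z | (fun y : Ω => aeval y (poly ℓ c))^[n] z = algebraMap K Ω a}

/-- The field `K_n = K(f^{-n}(a))`. -/
def level {K : Type*} [Field K] (Ω : Type*) [Field Ω] [Algebra K Ω]
    (ℓ : ℕ) (c a : K) (n : ℕ) : IntermediateField K Ω :=
  IntermediateField.adjoin K (preimages Ω ℓ c a n)

section Inertia

variable (K : Type*) [Field K] [Valued K ℤᵐ⁰] (L : Type*) [Field L] [Algebra K L]

/-- The ring of integers of an algebraic extension `L` of `K`: the integral closure in `L` of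
the valuation ring of `K`. For `K` complete (more generally henselian) this is the valuation ring
of the unique extension of the valuation to `L`, so it has exactly one maximal ideal. -/
abbrev integers : Subalgebra 𝒪[K] L := integralClosure 𝒪[K] L

variable {K L}

/-- The action of an element of `Aut(L/K)` on the ring of integers of `L`. -/
def actInt (σ : L ≃ₐ[K] L) : integers K L ≃ₐ[𝒪[K]] integers K L :=
  (σ.restrictScalars 𝒪[K]).mapIntegralClosure

theorem coe_actInt (σ : L ≃ₐ[K] L) (x : integers K L) :
    ((actInt σ x : integers K L) : L) = σ (x : L) := rfl

theorem actInt_mul (σ τ : L ≃ₐ[K] L) (x : integers K L) :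
    actInt (σ * τ) x = actInt σ (actInt τ x) := rfl

theorem actInt_one (x : integers K L) : actInt (1 : L ≃ₐ[K] L) x = x := rfl

theorem actInt_inv_left (σ : L ≃ₐ[K] L) (x : integers K L) :
    actInt σ⁻¹ (actInt σ x) = x := by
  rw [← actInt_mul, inv_mul_cancel, actInt_one]

theorem actInt_inv_right (σ : L ≃ₐ[K] L) (x : integers K L) :
    actInt σ (actInt σ⁻¹ x) = x := by
  rw [← actInt_mul, mul_inv_cancel, actInt_one]

theorem actInt_mem (σ : L ≃ₐ[K] L) {y : integers K L}
    (hy : ∀ M : Ideal (integers K L), M.IsMaximal → y ∈ M) :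
    ∀ M : Ideal (integers K L), M.IsMaximal → actInt σ y ∈ M := by
  intro M hM
  have h : (M.comap ((actInt σ : integers K L ≃ₐ[𝒪[K]] integers K L) :
      integers K L ≃+* integers K L)).IsMaximal :=
    Ideal.comap_isMaximal_of_equiv _
  exact hy _ h

variable (K L)

/-- The inertia subgroup of `Aut(L/K)`: the automorphisms acting trivially on the residue field
of the ring of integers of `L`, i.e. `σ x ≡ x` modulo the maximal ideal for every integer `x`. -/
def inertia : Subgroup (L ≃ₐ[K] L) where
  carrier := {σ | ∀ x : integers K L, ∀ M : Ideal (integers K L), M.IsMaximal →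
    actInt σ x - x ∈ M}
  one_mem' := by
    intro x M _
    rw [actInt_one, sub_self]
    exact M.zero_mem
  mul_mem' := by
    intro σ τ hσ hτ x M hM
    have h := M.add_mem (hσ (actInt τ x) M hM) (hτ x M hM)
    rwa [sub_add_sub_cancel, ← actInt_mul] at h
  inv_mem' := by
    intro σ hσ x M hM
    have h := M.neg_mem (hσ (actInt σ⁻¹ x) M hM)
    rwa [actInt_inv_right, neg_sub] at h

instance inertia_normal : (inertia K L).Normal where
  conj_mem := by
    intro τ hτ σ x M hM
    have h := actInt_mem σ (hτ (actInt σ⁻¹ x)) M hM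
    rwa [map_sub, actInt_inv_right, ← actInt_mul, ← actInt_mul] at h

end Inertia

end LocalArboreal

end

/-!
Write `|x|` for the extension to `Ω` of the absolute value of `K`; it is invariant under
conjugation over `K`. The `ℓ`-th roots of unity `ζ ≠ 1` satisfy `|ζ - 1| ^ (ℓ - 1) = |ℓ|`, both
when `ℓ` is a unit and when `ℓ` is the residue characteristic. Call `u` near `1` if
`|u - 1| ^ (ℓ - 1) < |ℓ|`: these elements form a group stable under conjugation and containing no
`ℓ`-th root of unity but `1`. Moreover, if `|u - 1| ^ (ℓ - 1) < |ℓ| ^ ℓ`, the product of the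
distances from `1` to the `ℓ`-th roots of `u` is so small that one of the roots is near `1`
(`exists_isNearOne_pow_eq`).

The hypothesis on `c` reads `1 < |c| ^ (ℓ - 1) * |ℓ| ^ ℓ`. By induction on the level, two
solutions of `f^n(z) = a` with `n ≥ 1` differ by a factor `ζ * u` with `ζ ^ ℓ = 1` and `u` near `1`
(`isNearTwist_of_mem_preimages`). This has two consequences.

* A Krasner-type argument (`IsNearTwist.mem`) shows that a field containing one solution of
  `f^n(z) = a` contains all the others, hence `K_n = K(α)`.
* For every member `β` of the forward orbit of `α`, the map sending `σ` to the root of unity `ζ`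
  in `σ β = ζ * β * u` is a character of `Gal(K_n/K)`, because `ζ` is determined by `ζ * u`
  (`exists_character`). An automorphism killed by these `n` characters fixes the orbit, starting
  from its end `a`, so it fixes `α` and is trivial (`exists_injective_hom_pi`).

For the quotient by inertia: if `ℓ` is a unit, all solutions are near twists of an `ℓ`-th root `γ`
of `c`, so that `K_n = K(γ)` for `n ≥ 1` and the whole Galois group is cyclic of order dividing `ℓ`
(`exists_injective_hom_rootsOfUnity_of_unit`). If `K` is `p`-adic, the quotient by inertia acts
faithfully on a finite residue field, so it is cyclic (`isCyclic_quotient_inertia`); being killed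
by `ℓ`, it has order dividing `ℓ`.
-/

namespace LocalArboreal

open Polynomial
open scoped NNReal

/-! ### Extending the valuation -/

section Extension

theorem IsFinitePadicExtension.charZero {K : Type*} [Field K] [Valued K ℤᵐ⁰] {p : ℕ}
    (h : IsFinitePadicExtension p K) : CharZero K := by
  obtain ⟨_, _, -, -⟩ := h
  exact charZero_of_injective_algebraMap (algebraMap ℚ_[p] K).injective

variable (K : Type*) [Field K] [Valued K ℤᵐ⁰]

/-- An element whose minimal polynomial over `K` has coefficients in `𝒪[K]`
is integral over `𝒪[K]`, and conversely because `𝒪[K]` is integrally closed. -/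
theorem isIntegral_iff_minpoly_coeff_mem {Ω : Type*} [Field Ω] [Algebra K Ω]
    [Algebra.IsAlgebraic K Ω] (x : Ω) :
    IsIntegral 𝒪[K] x ↔ ∀ i, Valued.v ((minpoly K x).coeff i) ≤ 1 := by
  have hx : IsIntegral K x := Algebra.IsIntegral.isIntegral x
  constructor
  · intro h i
    rw [minpoly.isIntegrallyClosed_eq_field_fractions' K h, coeff_map]
    exact ((minpoly 𝒪[K] x).coeff i).2
  · intro h
    have hp : (↑(minpoly K x).coeffs : Set K) ⊆ (𝒪[K] : Subring K) := by
      intro y hy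
      obtain ⟨i, -, rfl⟩ := mem_coeffs_iff.1 hy
      exact h i
    refine ⟨(minpoly K x).toSubring 𝒪[K] hp, (monic_toSubring _ _ _).2 (minpoly.monic hx), ?_⟩
    have h0 := minpoly.aeval K x
    rw [aeval_def, ← map_toSubring (minpoly K x) 𝒪[K] hp, eval₂_map] at h0
    exact h0

/-- The extension of the valuation of a complete discretely valued field to an algebraic
extension, recorded by what is needed of it: it extends the order of `K`, takes the same value
on conjugate elements, and its valuation ring is the integral closure of `𝒪[K]`. -/
theorem exists_valuation_extension [CompleteSpace K]
    [(Valued.v : Valuation K ℤᵐ⁰).IsRankOneDiscrete]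
    (Ω : Type*) [Field Ω] [Algebra K Ω] [Algebra.IsAlgebraic K Ω] :
    ∃ w : Valuation Ω ℝ≥0,
      (∀ x y : K, w (algebraMap K Ω x) ≤ w (algebraMap K Ω y) ↔
        (Valued.v x : ℤᵐ⁰) ≤ Valued.v y) ∧
      (∀ x y : Ω, minpoly K x = minpoly K y → w x = w y) ∧
      (∀ x : Ω, w x ≤ 1 ↔ IsIntegral 𝒪[K] x) := by
  let : (Valued.v : Valuation K ℤᵐ⁰).RankOne :=
    Valuation.IsRankOneDiscrete.rankOne _ (e := 2) (by norm_num)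
  let := Valued.toNontriviallyNormedField K ℤᵐ⁰
  refine ⟨{ toFun := fun x => ⟨spectralNorm K Ω x, spectralNorm_nonneg x⟩
            map_zero' := ?_
            map_one' := ?_
            map_mul' := ?_
            map_add_le_max' := ?_ }, ?_, ?_, ?_⟩
  · exact Subtype.ext spectralNorm_zero
  · exact Subtype.ext spectralNorm_one
  · exact fun x y => Subtype.ext (spectralAlgNorm_mul (K := K) (L := Ω) x y)
  · exact fun x y => isNonarchimedean_spectralNorm (K := K) (L := Ω) x y
  · intro x y
    change spectralNorm K Ω _ ≤ spectralNorm K Ω _ ↔ _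
    rw [spectralNorm_extends, spectralNorm_extends]
    exact Valued.toNormedField.norm_le_iff
  · intro x y h
    refine Subtype.ext ?_
    change spectralNorm K Ω x = spectralNorm K Ω y
    rw [spectralNorm, spectralNorm, h]
  · intro x
    change spectralValue (minpoly K x) ≤ 1 ↔ _
    rw [spectralValue_le_one_iff (minpoly.monic (Algebra.IsIntegral.isIntegral x)),
      isIntegral_iff_minpoly_coeff_mem]
    exact forall_congr' fun i => Valued.toNormedField.norm_le_one_iff

/-- A finite extension of `ℚ_p` is locally compact, so its ring of integers is compact and its
residue field is finite. -/
theorem IsFinitePadicExtension.isDiscreteValuationRing_and_finite {K : Type*} [Field K]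
    [Valued K ℤᵐ⁰] [(Valued.v : Valuation K ℤᵐ⁰).IsRankOneDiscrete] {p : ℕ}
    (h : IsFinitePadicExtension p K) :
    IsDiscreteValuationRing 𝒪[K] ∧ Finite 𝓀[K] := by
  obtain ⟨hp, hA, hfin, hcont⟩ := h
  let : (Valued.v : Valuation K ℤᵐ⁰).RankOne :=
    Valuation.IsRankOneDiscrete.rankOne _ (e := 2) (by norm_num)
  let := Valued.toNontriviallyNormedField K ℤᵐ⁰
  have : ContinuousSMul ℚ_[p] K := ⟨by
    simp only [Algebra.smul_def]
    exact (hcont.comp continuous_fst).mul continuous_snd⟩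
  have : LocallyCompactSpace K := .of_finiteDimensional_of_complete ℚ_[p] K
  have : ProperSpace K := .of_locallyCompactSpace K
  exact (Valued.integer.compactSpace_iff_completeSpace_and_isDiscreteValuationRing_and_finite_residueField.1
    (Valued.integer.properSpace_iff_compactSpace_integer.1 ‹_›)).2

end Extension

/-! ### Distances between roots of unity -/

section RootsOfUnity

variable {Ω : Type*} [Field Ω] {Γ : Type*} [LinearOrderedCommGroupWithZero Γ]
  (w : Valuation Ω Γ) {ℓ : ℕ} {ζ : Ω}

theorem map_eq_one_of_pow_eq_one (hℓ : ℓ ≠ 0) (hζ : ζ ^ ℓ = 1) : w ζ = 1 :=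
  (pow_eq_one_iff_of_nonneg zero_le hℓ).1 (by rw [← map_pow, hζ, map_one])

theorem map_one_sub_pow_le (hζ : w ζ = 1) (j : ℕ) : w (1 - ζ ^ j) ≤ w (1 - ζ) := by
  rw [← mul_neg_geom_sum, map_mul]
  refine mul_le_of_le_one_right' (w.map_sum_le fun i _ => ?_)
  rw [map_pow, hζ, one_pow]

/-- For `ζ ≠ 1`, the relation `∑ ζ ^ i = 0` gives `ℓ = ∑ (1 - ζ ^ i)`. -/
theorem map_natCast_le_map_one_sub (hℓ : ℓ ≠ 0) (hζ : ζ ^ ℓ = 1) (h1 : ζ ≠ 1) :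
    w (ℓ : Ω) ≤ w (1 - ζ) := by
  have hsum : ∑ i ∈ Finset.range ℓ, ζ ^ i = 0 := by
    have h := geom_sum_mul ζ ℓ
    rw [hζ, sub_self] at h
    exact (mul_eq_zero.1 h).resolve_right (sub_ne_zero.2 h1)
  have hℓ' : (ℓ : Ω) = ∑ i ∈ Finset.range ℓ, (1 - ζ ^ i) := by
    rw [Finset.sum_sub_distrib, hsum]; simp
  rw [hℓ']
  exact w.map_sum_le fun i _ => map_one_sub_pow_le w (map_eq_one_of_pow_eq_one w hℓ hζ) i

/-- If `ℓ` is a unit for `w`, distinct `ℓ`-th roots of unity have distinct residues. -/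
theorem map_sub_one_pow_of_unit (hℓ : ℓ ≠ 0) (hw : w (ℓ : Ω) = 1) (hζ : ζ ^ ℓ = 1)
    (h1 : ζ ≠ 1) : w (ζ - 1) ^ (ℓ - 1) = w (ℓ : Ω) := by
  have hle : w (1 - ζ) ≤ 1 := by
    refine (w.map_sub _ _).trans ?_
    rw [map_one, map_eq_one_of_pow_eq_one w hℓ hζ, max_self]
  have h := le_antisymm hle (hw.symm.trans_le (map_natCast_le_map_one_sub w hℓ hζ h1))
  rw [w.map_sub_swap, h, one_pow, hw]

/-- For `ℓ` prime, the factors of `ℓ = ∏_{0<k<ℓ} (1 - ζ ^ k)` divide each other. -/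
theorem map_sub_one_pow_of_prime (hℓ : ℓ.Prime) (hζ : ζ ^ ℓ = 1) (h1 : ζ ≠ 1) :
    w (ζ - 1) ^ (ℓ - 1) = w (ℓ : Ω) := by
  have hprim : IsPrimitiveRoot ζ ℓ := by
    have := (Nat.dvd_prime hℓ).1 (orderOf_dvd_of_pow_eq_one hζ)
    have h2 : orderOf ζ = ℓ := this.resolve_left (by rwa [orderOf_eq_one_iff])
    exact h2 ▸ IsPrimitiveRoot.orderOf ζ
  have hwζ := map_eq_one_of_pow_eq_one w hℓ.ne_zero hζ
  obtain ⟨n, rfl⟩ : ∃ n, ℓ = n + 1 := ⟨ℓ - 1, (Nat.sub_add_cancel hℓ.one_le).symm⟩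
  have hprod := hprim.prod_one_sub_pow_eq_order
  rw [Nat.cast_succ, ← hprod, map_prod, Nat.add_sub_cancel, w.map_sub_swap]
  rw [Finset.prod_congr rfl (g := fun _ => w (1 - ζ)), Finset.prod_const, Finset.card_range]
  intro k hk
  refine le_antisymm (map_one_sub_pow_le w hwζ _) ?_
  have hcop : (k + 1).Coprime (n + 1) :=
    (Nat.coprime_of_lt_prime k.succ_ne_zero
      (Nat.succ_lt_succ (Finset.mem_range.1 hk)) hℓ).symm
  obtain ⟨m, -, hm⟩ := Nat.exists_mul_mod_eq_one_of_coprime hcop hℓ.one_lt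
  have hζm : (ζ ^ (k + 1)) ^ m = ζ := by
    rw [← pow_mul, ← pow_mod_orderOf, ← hprim.eq_orderOf, hm, pow_one]
  calc w (1 - ζ) = w (1 - (ζ ^ (k + 1)) ^ m) := by rw [hζm]
    _ ≤ _ := map_one_sub_pow_le w (by rw [map_pow, hwζ, one_pow]) m

end RootsOfUnity

/-! ### Elements near `1` -/

section Near

variable {Ω : Type*} [Field Ω] {Γ : Type*} [LinearOrderedCommGroupWithZero Γ]

/-- `IsNearOne w ℓ x` says that `x` is so close to `1` that no `ℓ`-th root of unity other than `1`
is as close: additively, `v(x - 1) > v(ℓ) / (ℓ - 1)`. -/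
def IsNearOne (w : Valuation Ω Γ) (ℓ : ℕ) (x : Ω) : Prop :=
  w (x - 1) ^ (ℓ - 1) < w (ℓ : Ω)

variable {w : Valuation Ω Γ} {ℓ : ℕ} {x y : Ω}

theorem map_natCast_le_one (w : Valuation Ω Γ) (n : ℕ) : w (n : Ω) ≤ 1 := by
  induction n with
  | zero => simp
  | succ n ih =>
    rw [Nat.cast_succ]
    exact (w.map_add _ _).trans (max_le ih w.map_one.le)

theorem IsNearOne.map_sub_one_lt (h : IsNearOne w ℓ x) : w (x - 1) < 1 := by
  by_contra hle
  exact absurd (h.trans_le (map_natCast_le_one w ℓ)) (not_lt.2 (one_le_pow₀ (not_lt.1 hle)))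

theorem IsNearOne.map_eq_one (h : IsNearOne w ℓ x) : w x = 1 := by
  have := w.map_one_add_of_lt h.map_sub_one_lt
  rwa [add_sub_cancel] at this

theorem IsNearOne.ne_zero (h : IsNearOne w ℓ x) : x ≠ 0 := by
  rintro rfl
  simpa using h.map_eq_one

theorem IsNearOne.mul (hx : IsNearOne w ℓ x) (hy : IsNearOne w ℓ y) :
    IsNearOne w ℓ (x * y) := by
  have hle : w (x * y - 1) ≤ max (w (x - 1)) (w (y - 1)) := by
    rw [show x * y - 1 = (x - 1) * y + (y - 1) by ring]
    refine (w.map_add _ _).trans ?_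
    rw [map_mul, hy.map_eq_one, mul_one]
  unfold IsNearOne at *
  rcases le_max_iff.1 hle with h | h
  · exact (pow_le_pow_left' h _).trans_lt hx
  · exact (pow_le_pow_left' h _).trans_lt hy

theorem IsNearOne.inv (hx : IsNearOne w ℓ x) : IsNearOne w ℓ x⁻¹ := by
  have h0 := hx.ne_zero
  have : w (x⁻¹ - 1) = w (x - 1) := by
    rw [show x⁻¹ - 1 = (1 - x) * x⁻¹ by field_simp, map_mul, map_inv₀, hx.map_eq_one, inv_one,
      mul_one, w.map_sub_swap]
  unfold IsNearOne at *
  rwa [this]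

/-- If `u` is close to `1`, the product of the distances from `1` to its `ℓ`-th roots is small,
so one of these roots is near `1`. -/
theorem exists_isNearOne_pow_eq [IsAlgClosed Ω] (hℓ : ℓ ≠ 0) {u : Ω}
    (hu : w (u - 1) ^ (ℓ - 1) < w (ℓ : Ω) ^ ℓ) : ∃ y, IsNearOne w ℓ y ∧ y ^ ℓ = u := by
  by_contra! hno
  set P : Polynomial Ω := X ^ ℓ - C u
  have hmon : P.Monic := monic_X_pow_sub_C u hℓ
  have hroot : ∀ r ∈ P.roots, w (ℓ : Ω) ≤ w (1 - r) ^ (ℓ - 1) := by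
    intro r hr
    rw [w.map_sub_swap]
    refine not_lt.1 fun hlt => hno r hlt ?_
    have h := (mem_roots'.1 hr).2
    simpa [P, sub_eq_zero] using h
  have hprod := (IsAlgClosed.splits P).eq_prod_roots_of_monic hmon
  have hcard : P.roots.card = ℓ := by
    rw [← (IsAlgClosed.splits P).natDegree_eq_card_roots, natDegree_X_pow_sub_C]
  have heval : 1 - u = (P.roots.map fun r => 1 - r).prod := by
    have h := congrArg (eval 1) hprod
    rw [eval_multiset_prod, Multiset.map_map] at h
    simpa [P] using h
  rw [w.map_sub_swap, heval, map_multiset_prod, Multiset.map_map, ← Multiset.prod_map_pow] at hu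
  refine absurd hu (not_lt.2 ?_)
  calc w (ℓ : Ω) ^ ℓ = (P.roots.map fun _ => w (ℓ : Ω)).prod := by
        rw [Multiset.map_const', Multiset.prod_replicate, hcard]
    _ ≤ _ := Multiset.prod_map_le_prod_map _ _ hroot

end Near

/-! ### Near twists -/

section Twist

variable {Ω : Type*} [Field Ω] {Γ : Type*} [LinearOrderedCommGroupWithZero Γ]
  {w : Valuation Ω Γ} {ℓ : ℕ} {x y : Ω}

/-- `y` is a near twist of `x` if `y / x` is an `ℓ`-th root of unity up to a factor near `1`. -/
def IsNearTwist (w : Valuation Ω Γ) (ℓ : ℕ) (x y : Ω) : Prop :=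
  ∃ ζ : Ω, ζ ^ ℓ = 1 ∧ ∃ u, IsNearOne w ℓ u ∧ y = ζ * x * u

theorem ne_zero_of_pow_eq_one (hℓ : ℓ ≠ 0) {ζ : Ω} (hζ : ζ ^ ℓ = 1) : ζ ≠ 0 := by
  rintro rfl
  simp [hℓ] at hζ

theorem IsNearTwist.symm (hℓ : ℓ ≠ 0) (h : IsNearTwist w ℓ x y) : IsNearTwist w ℓ y x := by
  obtain ⟨ζ, hζ, u, hu, rfl⟩ := h
  refine ⟨ζ⁻¹, by rw [inv_pow, hζ, inv_one], u⁻¹, hu.inv, ?_⟩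
  have h1 := hu.ne_zero
  have h2 := ne_zero_of_pow_eq_one hℓ hζ
  field_simp

theorem IsNearOne.eq_one (hμ : ∀ ζ : Ω, ζ ^ ℓ = 1 → ζ ≠ 1 → w (ζ - 1) ^ (ℓ - 1) = w (ℓ : Ω))
    (hx : IsNearOne w ℓ x) (h1 : x ^ ℓ = 1) : x = 1 := by
  by_contra hne
  exact hx.ne (hμ x h1 hne)

theorem IsNearTwist.of_pow [IsAlgClosed Ω] (hℓ : ℓ ≠ 0) (hx : x ≠ 0)
    (h : w (y ^ ℓ - x ^ ℓ) ^ (ℓ - 1) < w (x ^ ℓ) ^ (ℓ - 1) * w (ℓ : Ω) ^ ℓ) :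
    IsNearTwist w ℓ x y := by
  have hxℓ : x ^ ℓ ≠ 0 := pow_ne_zero _ hx
  have hw : 0 < w (x ^ ℓ) ^ (ℓ - 1) := pow_pos (zero_lt_iff.2 ((w.ne_zero_iff).2 hxℓ)) _
  obtain ⟨u, hu, huℓ⟩ := exists_isNearOne_pow_eq (w := w) hℓ (u := y ^ ℓ / x ^ ℓ) (by
    rw [div_sub_one hxℓ, map_div₀, div_pow, div_lt_iff₀ hw, mul_comm]
    exact h)
  have hu0 := hu.ne_zero
  refine ⟨y / (x * u), ?_, u, hu, by field_simp⟩
  have hy : y ^ ℓ = x ^ ℓ * u ^ ℓ := by rw [huℓ]; field_simp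
  rw [div_pow, mul_pow, ← hy, div_self]
  rw [hy]
  exact mul_ne_zero hxℓ (pow_ne_zero _ hu0)

theorem IsNearTwist.map_sub_pow_le
    (hμ : ∀ ζ : Ω, ζ ^ ℓ = 1 → ζ ≠ 1 → w (ζ - 1) ^ (ℓ - 1) = w (ℓ : Ω)) (hℓ : 2 ≤ ℓ)
    (h : IsNearTwist w ℓ x y) : w (y - x) ^ (ℓ - 1) ≤ w x ^ (ℓ - 1) * w (ℓ : Ω) := by
  obtain ⟨ζ, hζ, u, hu, rfl⟩ := h
  have hle : w (ζ - 1) ^ (ℓ - 1) ≤ w (ℓ : Ω) := by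
    rcases eq_or_ne ζ 1 with rfl | h1
    · rw [sub_self, map_zero, zero_pow (by omega)]
      exact zero_le
    · exact (hμ ζ hζ h1).le
  rw [show ζ * x * u - x = x * (ζ * (u - 1) + (ζ - 1)) by ring, map_mul, mul_pow]
  refine mul_le_mul_right ?_ _
  have hmax := w.map_add (ζ * (u - 1)) (ζ - 1)
  rw [map_mul, map_eq_one_of_pow_eq_one w (by omega) hζ, one_mul] at hmax
  rcases le_max_iff.1 hmax with h | h
  · exact (pow_le_pow_left' h _).trans (le_of_lt hu)
  · exact (pow_le_pow_left' h _).trans hle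

end Twist

/-! ### Descent of near twists -/

section Descent

variable {K : Type*} [Field K] {Ω : Type*} [Field Ω] [Algebra K Ω] [IsAlgClosed Ω]
  [Algebra.IsAlgebraic K Ω] {Γ : Type*} [LinearOrderedCommGroupWithZero Γ] {w : Valuation Ω Γ}
  {ℓ : ℕ}

/-- A form of Krasner's lemma: a conjugate of `y` over `E` is `ζ * y` for some root of unity `ζ`,
and comparison with `x` shows that `ζ` is near `1`, hence equal to `1`. -/
theorem IsNearTwist.mem
    (hinv : ∀ x y : Ω, minpoly K x = minpoly K y → w x = w y)
    (hμ : ∀ ζ : Ω, ζ ^ ℓ = 1 → ζ ≠ 1 → w (ζ - 1) ^ (ℓ - 1) = w (ℓ : Ω))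
    (hK : ∀ ζ : Ω, ζ ^ ℓ = 1 → ζ ∈ Set.range (algebraMap K Ω))
    (hℓ : (ℓ : Ω) ≠ 0) (E : IntermediateField K Ω) {x y : Ω} (hx : x ∈ E) (hx0 : x ≠ 0)
    (hy : y ^ ℓ ∈ E) (h : IsNearTwist w ℓ x y) : y ∈ E := by
  have hℓ0 : ℓ ≠ 0 := by rintro rfl; simp at hℓ
  obtain ⟨ζ, hζ, u, hu, rfl⟩ := h
  obtain ⟨z, rfl⟩ := hK ζ hζ
  have hu0 := hu.ne_zero
  have hζ0 := ne_zero_of_pow_eq_one hℓ0 hζ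
  set y := algebraMap K Ω z * x * u with hydef
  have hy0 : y ≠ 0 := mul_ne_zero (mul_ne_zero hζ0 hx0) hu0
  have hEℓ : ((ℓ : ℕ) : E) ≠ 0 := fun h0 => hℓ (by
    have := congrArg (algebraMap E Ω) h0
    simpa using this)
  have hsep : IsSeparable E y := by
    refine Separable.of_dvd (separable_X_pow_sub_C (⟨y ^ ℓ, hy⟩ : E) hEℓ ?_) (minpoly.dvd _ _ ?_)
    · exact fun h0 => pow_ne_zero ℓ hy0 (congrArg Subtype.val h0)
    · simp only [map_sub, map_pow, aeval_X, aeval_C]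
      exact sub_self _
  by_contra hnot
  have hbot : y ∉ (⊥ : Subalgebra E Ω) := by
    rintro ⟨e, he⟩
    exact hnot (he ▸ e.2)
  have : Algebra.IsAlgebraic E Ω := Algebra.IsAlgebraic.tower_top (K := K) E
  have : IsAlgClosure E Ω := ⟨‹_›, ‹_›⟩
  have : Normal E Ω := IsAlgClosure.normal E Ω
  obtain ⟨y', hne, hconj⟩ := (notMem_iff_exists_ne_and_isConjRoot hsep
    (IsAlgClosed.splits _)).1 hbot
  obtain ⟨σ, hσ⟩ := hconj.symm.exists_algEquiv
  have hσx : σ x = x := σ.commutes ⟨x, hx⟩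
  have hσz : σ (algebraMap K Ω z) = algebraMap K Ω z := (σ.restrictScalars K).commutes z
  have hσy : y' ^ ℓ = y ^ ℓ := by
    rw [← hσ, ← map_pow]
    exact σ.commutes ⟨y ^ ℓ, hy⟩
  have hσu : IsNearOne w ℓ (σ u) := by
    have h1 : w (σ u - 1) = w (u - 1) := by
      rw [← map_one σ, ← map_sub, map_one]
      exact hinv _ _ (minpoly.algEquiv_eq (σ.restrictScalars K) (u - 1))
    unfold IsNearOne at *
    rwa [h1]
  have hq : y' / y = σ u * u⁻¹ := by
    rw [← hσ, hydef, map_mul, map_mul, hσx, hσz]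
    field_simp
  have h1 : y' / y = 1 := (hq ▸ hσu.mul hu.inv).eq_one hμ (by
    rw [div_pow, hσy, div_self (pow_ne_zero _ hy0)])
  exact hne ((div_eq_one_iff_eq hy0).1 h1).symm

end Descent

/-! ### Iterated preimages -/

section Preimages

variable {K : Type*} [Field K] {Ω : Type*} [Field Ω] [Algebra K Ω] {ℓ n : ℕ} {c a : K} {z : Ω}

theorem mem_preimages_zero : z ∈ preimages Ω ℓ c a 0 ↔ z = algebraMap K Ω a := Iff.rfl

theorem mem_preimages_succ :
    z ∈ preimages Ω ℓ c a (n + 1) ↔ z ^ ℓ - algebraMap K Ω c ∈ preimages Ω ℓ c a n := by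
  simp only [preimages, Set.mem_ofPred_eq, Function.iterate_succ_apply, poly, map_sub, map_pow,
    aeval_X, aeval_C]

theorem preimages_nonempty [IsAlgClosed Ω] (hℓ : ℓ ≠ 0) : (preimages Ω ℓ c a n).Nonempty := by
  induction n with
  | zero => exact ⟨_, rfl⟩
  | succ n ih =>
    obtain ⟨b, hb⟩ := ih
    obtain ⟨z, hz⟩ := IsAlgClosed.exists_pow_nat_eq (b + algebraMap K Ω c) (Nat.pos_of_ne_zero hℓ)
    exact ⟨z, mem_preimages_succ.2 (by rwa [hz, add_sub_cancel_right])⟩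

theorem algEquiv_mem_preimages {S : Type*} [Field S] [Algebra K S] (f : S →ₐ[K] Ω)
    (σ : S ≃ₐ[K] S) {z : S} (hz : f z ∈ preimages Ω ℓ c a n) :
    f (σ z) ∈ preimages Ω ℓ c a n := by
  induction n generalizing z with
  | zero =>
    rw [mem_preimages_zero, ← f.commutes] at hz
    replace hz := f.injective hz
    rw [mem_preimages_zero, hz, σ.commutes, f.commutes]
  | succ n ih =>
    rw [mem_preimages_succ] at hz ⊢
    have h := ih (z := z ^ ℓ - algebraMap K S c) (by simpa using hz)
    simpa using h

end Preimages

/-! ### Comparing iterated preimages -/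

section Estimates

variable {K : Type*} [Field K] {Ω : Type*} [Field Ω] [Algebra K Ω]
  {Γ : Type*} [LinearOrderedCommGroupWithZero Γ] {w : Valuation Ω Γ} {ℓ n : ℕ} {c a : K}

theorem one_lt_of_one_lt_pow_mul (hc : 1 < w (algebraMap K Ω c) ^ (ℓ - 1) * w (ℓ : Ω) ^ ℓ) :
    1 < w (algebraMap K Ω c) := by
  by_contra hle
  refine absurd hc (not_lt.2 (mul_le_one' (pow_le_one' (not_lt.1 hle) _) ?_))
  exact pow_le_one' (map_natCast_le_one w ℓ) _

theorem map_lt_of_mem_preimages (hℓ : 2 ≤ ℓ) (h1 : 1 < w (algebraMap K Ω c))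
    (ha : w (algebraMap K Ω a) < w (algebraMap K Ω c)) {z : Ω}
    (hz : z ∈ preimages Ω ℓ c a n) : w z < w (algebraMap K Ω c) := by
  induction n generalizing z with
  | zero => rwa [mem_preimages_zero.1 hz]
  | succ n ih =>
    have h := w.map_add_eq_of_lt_left (ih (mem_preimages_succ.1 hz))
    rw [add_sub_cancel, map_pow] at h
    have hz1 : 1 < w z := by
      by_contra hle
      exact absurd h1 (not_lt.2 (h ▸ pow_le_one' (not_lt.1 hle) _))
    calc w z = w z ^ 1 := (pow_one _).symm
      _ < w z ^ ℓ := pow_lt_pow_right₀ hz1 (by omega)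
      _ = _ := h

theorem map_pow_of_mem_preimages_succ (hℓ : 2 ≤ ℓ) (h1 : 1 < w (algebraMap K Ω c))
    (ha : w (algebraMap K Ω a) < w (algebraMap K Ω c)) {z : Ω}
    (hz : z ∈ preimages Ω ℓ c a (n + 1)) : w (z ^ ℓ) = w (algebraMap K Ω c) := by
  have h := w.map_add_eq_of_lt_left
    (map_lt_of_mem_preimages hℓ h1 ha (mem_preimages_succ.1 hz))
  rwa [add_sub_cancel] at h

theorem ne_zero_of_mem_preimages_succ (hℓ : 2 ≤ ℓ) (h1 : 1 < w (algebraMap K Ω c))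
    (ha : w (algebraMap K Ω a) < w (algebraMap K Ω c)) {z : Ω}
    (hz : z ∈ preimages Ω ℓ c a (n + 1)) : z ≠ 0 := by
  rintro rfl
  have h := map_pow_of_mem_preimages_succ hℓ h1 ha hz
  rw [zero_pow (by omega), map_zero] at h
  rw [← h] at h1
  exact not_lt_zero h1

variable [IsAlgClosed Ω]

/-- The estimate which drives the induction: elements of the same level are so close to each
other, relative to `c`, that their preimages are near twists of each other. -/
theorem map_sub_pow_lt_of_mem_preimages (hℓ : 2 ≤ ℓ)
    (hμ : ∀ ζ : Ω, ζ ^ ℓ = 1 → ζ ≠ 1 → w (ζ - 1) ^ (ℓ - 1) = w (ℓ : Ω))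
    (hc : 1 < w (algebraMap K Ω c) ^ (ℓ - 1) * w (ℓ : Ω) ^ ℓ)
    (ha : w (algebraMap K Ω a) < w (algebraMap K Ω c)) {x y : Ω}
    (hx : x ∈ preimages Ω ℓ c a n) (hy : y ∈ preimages Ω ℓ c a n) :
    w (y - x) ^ (ℓ - 1) < w (algebraMap K Ω c) ^ (ℓ - 1) * w (ℓ : Ω) ^ ℓ := by
  have h1 := one_lt_of_one_lt_pow_mul hc
  induction n generalizing x y with
  | zero =>
    rw [mem_preimages_zero.1 hx, mem_preimages_zero.1 hy, sub_self, map_zero,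
      zero_pow (by omega)]
    exact zero_lt_one.trans hc
  | succ n ih =>
    have hwx := map_pow_of_mem_preimages_succ hℓ h1 ha hx
    have hlt := ih (mem_preimages_succ.1 hx) (mem_preimages_succ.1 hy)
    rw [sub_sub_sub_cancel_right, ← hwx] at hlt
    have htw := IsNearTwist.of_pow (by omega) (ne_zero_of_mem_preimages_succ hℓ h1 ha hx) hlt
    refine (htw.map_sub_pow_le hμ hℓ).trans_lt ?_
    set t := w x ^ (ℓ - 1) * w (ℓ : Ω) with ht
    -- With `t = |x|^(ℓ-1) |ℓ|`, the hypothesis on `c` reads `1 < t^ℓ`, and the goal is `t < t^ℓ`.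
    have htℓ : w (algebraMap K Ω c) ^ (ℓ - 1) * w (ℓ : Ω) ^ ℓ = t ^ ℓ := by
      rw [ht, ← hwx, map_pow, mul_pow, ← pow_mul, ← pow_mul, mul_comm ℓ]
    rw [htℓ] at hc ⊢
    have ht1 : 1 < t := by
      by_contra hle
      exact absurd hc (not_lt.2 (pow_le_one' (not_lt.1 hle) _))
    calc t = t ^ 1 := (pow_one _).symm
      _ < t ^ ℓ := pow_lt_pow_right₀ ht1 (by omega)

theorem isNearTwist_of_mem_preimages (hℓ : 2 ≤ ℓ)
    (hμ : ∀ ζ : Ω, ζ ^ ℓ = 1 → ζ ≠ 1 → w (ζ - 1) ^ (ℓ - 1) = w (ℓ : Ω))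
    (hc : 1 < w (algebraMap K Ω c) ^ (ℓ - 1) * w (ℓ : Ω) ^ ℓ)
    (ha : w (algebraMap K Ω a) < w (algebraMap K Ω c)) {x y : Ω}
    (hx : x ∈ preimages Ω ℓ c a (n + 1)) (hy : y ∈ preimages Ω ℓ c a (n + 1)) :
    IsNearTwist w ℓ x y := by
  have h1 := one_lt_of_one_lt_pow_mul hc
  refine IsNearTwist.of_pow (by omega) (ne_zero_of_mem_preimages_succ hℓ h1 ha hx) ?_
  rw [map_pow_of_mem_preimages_succ hℓ h1 ha hx]
  have h := map_sub_pow_lt_of_mem_preimages hℓ hμ hc ha (mem_preimages_succ.1 hx)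
    (mem_preimages_succ.1 hy)
  rwa [sub_sub_sub_cancel_right] at h

end Estimates

/-! ### Inertia and the residue field -/

section ResidueField

/-- The quotient of `G` by the subgroup acting trivially on the residue field of `B` is faithfully
represented on this field, and the automorphism group of a finite field is cyclic. -/
theorem isCyclic_quotient_of_residueField {R B : Type*} [CommRing R] [CommRing B] [IsLocalRing R]
    [IsLocalRing B] [Algebra R B] [Module.Finite R B] [IsLocalHom (algebraMap R B)]
    [Finite (IsLocalRing.ResidueField R)] {G : Type*} [Group G] (ρ : G → (B ≃ₐ[R] B))
    (hρ : ∀ σ τ x, ρ (σ * τ) x = ρ σ (ρ τ x)) (I : Subgroup G) [I.Normal]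
    (hI : ∀ σ, σ ∈ I ↔ ∀ x, ρ σ x - x ∈ IsLocalRing.maximalIdeal B) : IsCyclic (G ⧸ I) := by
  have : Finite (IsLocalRing.ResidueField B) :=
    IsLocalRing.ResidueField.finite_of_finite (R := R) ‹_›
  let φ : G →* (IsLocalRing.ResidueField B ≃ₐ[IsLocalRing.ResidueField R]
      IsLocalRing.ResidueField B) :=
    MonoidHom.mk' (fun σ => IsLocalRing.ResidueField.mapAlgEquiv' (ρ σ)) fun σ τ => by
      ext x
      obtain ⟨x, rfl⟩ := IsLocalRing.residue_surjective x
      exact congrArg (IsLocalRing.residue B) (hρ σ τ x)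
  have hker : φ.ker = I := by
    ext σ
    rw [MonoidHom.mem_ker, hI]
    have hiff : ∀ x : B, IsLocalRing.residue B (ρ σ x) = IsLocalRing.residue B x ↔
        ρ σ x - x ∈ IsLocalRing.maximalIdeal B := fun x => Ideal.Quotient.eq
    constructor
    · intro h x
      rw [← hiff]
      exact DFunLike.congr_fun h (IsLocalRing.residue _ x)
    · intro h
      ext x
      obtain ⟨x, rfl⟩ := IsLocalRing.residue_surjective x
      exact (hiff x).2 (h x)
  subst hker
  exact isCyclic_of_injective (QuotientGroup.kerLift φ) (QuotientGroup.kerLift_injective φ)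

end ResidueField

section Integers

variable (K : Type*) [Field K] [Valued K ℤᵐ⁰] [CompleteSpace K]
  [(Valued.v : Valuation K ℤᵐ⁰).IsRankOneDiscrete]
  (L : Type*) [Field L] [Algebra K L] [Algebra.IsAlgebraic K L]

/-- The units of the ring of integers are the elements of valuation `1`, and `x` and `1 - x`
cannot both have valuation less than `1`. -/
theorem isLocalRing_integers : IsLocalRing (integers K L) := by
  obtain ⟨w, -, -, hint⟩ := exists_valuation_extension K L
  have hunit : ∀ x : integers K L, w (x : L) = 1 → IsUnit x := by
    intro x hx
    have hx0 : (x : L) ≠ 0 := by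
      intro h0
      simp [h0] at hx
    have hinv : IsIntegral 𝒪[K] (x : L)⁻¹ := (hint _).1 (by rw [map_inv₀, hx, inv_one])
    exact IsUnit.of_mul_eq_one ⟨(x : L)⁻¹, hinv⟩ (Subtype.ext (mul_inv_cancel₀ hx0))
  refine IsLocalRing.of_isUnit_or_isUnit_one_sub_self fun x => ?_
  rcases ((hint x).2 x.2).eq_or_lt with h | h
  · exact Or.inl (hunit x h)
  · exact Or.inr (hunit _ (w.map_one_sub_of_lt h))

theorem isCyclic_quotient_inertia [IsDiscreteValuationRing 𝒪[K]] [Finite 𝓀[K]]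
    [FiniteDimensional K L] [Algebra.IsSeparable K L] :
    IsCyclic ((L ≃ₐ[K] L) ⧸ inertia K L) := by
  have hloc := isLocalRing_integers K L
  have : Module.Finite 𝒪[K] (integers K L) := IsIntegralClosure.finite 𝒪[K] K L (integers K L)
  have : Algebra.IsIntegral 𝒪[K] (integers K L) := Algebra.IsIntegral.of_finite _ _
  have hinj : Function.Injective (algebraMap 𝒪[K] (integers K L)) := fun x y h =>
    Subtype.ext ((algebraMap K L).injective (congrArg Subtype.val h))
  have : FaithfulSMul 𝒪[K] (integers K L) := (faithfulSMul_iff_algebraMap_injective _ _).2 hinj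
  have : IsLocalHom (algebraMap 𝒪[K] (integers K L)) :=
    Algebra.IsIntegral.isLocalHom _ _
  refine isCyclic_quotient_of_residueField (R := 𝒪[K]) (B := integers K L)
    actInt actInt_mul _ fun σ => ?_
  constructor
  · exact fun h x => h x _ inferInstance
  · intro h x M hM
    rw [IsLocalRing.eq_maximalIdeal hM]
    exact h x

end Integers

/-! ### Characters of the Galois group -/

section Characters

variable {K : Type*} [Field K] {Ω : Type*} [Field Ω] [Algebra K Ω]
  {Γ : Type*} [LinearOrderedCommGroupWithZero Γ] {w : Valuation Ω Γ} {ℓ : ℕ}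

theorem isNearOne_algEquiv {L : IntermediateField K Ω}
    (hinv : ∀ x y : Ω, minpoly K x = minpoly K y → w x = w y) (σ : L ≃ₐ[K] L) {x : L}
    (hx : IsNearOne w ℓ (x : Ω)) : IsNearOne w ℓ (σ x : Ω) := by
  have h1 : w ((σ x : Ω) - 1) = w ((x : Ω) - 1) := by
    refine hinv _ _ ?_
    have h := minpoly.algEquiv_eq σ (x - 1)
    rw [← minpoly.algHom_eq L.val L.val.injective, ← minpoly.algHom_eq L.val L.val.injective] at h
    simpa using h
  unfold IsNearOne at *
  rwa [h1]

/-- If every conjugate of `β` is a near twist of `β`, the root of unity involved is a character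
of the automorphism group. -/
theorem exists_character
    (hinv : ∀ x y : Ω, minpoly K x = minpoly K y → w x = w y)
    (hμ : ∀ ζ : Ω, ζ ^ ℓ = 1 → ζ ≠ 1 → w (ζ - 1) ^ (ℓ - 1) = w (ℓ : Ω))
    (hK : ∀ ζ : Ω, ζ ^ ℓ = 1 → ζ ∈ Set.range (algebraMap K Ω)) [NeZero ℓ]
    {L : IntermediateField K Ω} {β : L} (hβ : β ≠ 0)
    (h : ∀ σ : L ≃ₐ[K] L, IsNearTwist w ℓ (β : Ω) (σ β)) :
    ∃ χ : (L ≃ₐ[K] L) →* rootsOfUnity ℓ Ω, ∀ σ, ∃ u, IsNearOne w ℓ u ∧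
      (σ β : Ω) = ((χ σ : Ωˣ) : Ω) * β * u := by
  have hℓ : ℓ ≠ 0 := NeZero.ne ℓ
  have hβ' : (β : Ω) ≠ 0 := fun h0 => hβ (Subtype.ext h0)
  choose ζ hζ u hu hσ using h
  refine ⟨MonoidHom.mk' (fun σ => rootsOfUnity.mkOfPowEq (ζ σ) (hζ σ)) fun σ τ => ?_,
    fun σ => ⟨u σ, hu σ, hσ σ⟩⟩
  have hζ0 := fun σ => ne_zero_of_pow_eq_one hℓ (hζ σ)
  have hu0 := fun σ => (hu σ).ne_zero
  obtain ⟨z, hz⟩ := hK _ (hζ τ)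
  -- The factor `u τ` lies in `L`, so that `σ` can be applied to it.
  obtain ⟨y, hy⟩ : ∃ y : L, (y : Ω) = u τ := by
    refine ⟨τ β / (algebraMap K L z * β), ?_⟩
    have : ((algebraMap K L z : L) : Ω) = ζ τ := hz
    rw [IntermediateField.coe_div, IntermediateField.coe_mul, this, hσ τ]
    have := hζ0 τ
    field_simp
  have hy1 : IsNearOne w ℓ (σ y : Ω) := isNearOne_algEquiv hinv σ (hy ▸ hu τ)
  have hτL : τ β = algebraMap K L z * β * y := Subtype.ext (by
    rw [hσ τ, ← hz, ← hy]; rfl)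
  have hmul : ((σ * τ) β : Ω) = ζ τ * (ζ σ * β * u σ) * (σ y : Ω) := by
    rw [AlgEquiv.mul_apply, hτL, map_mul, map_mul, σ.commutes, IntermediateField.coe_mul,
      IntermediateField.coe_mul, hσ σ, ← hz]
    rfl
  have hy0 := hy1.ne_zero
  have hq : ζ (σ * τ) * (ζ σ * ζ τ)⁻¹ = u σ * (σ y : Ω) * (u (σ * τ))⁻¹ := by
    have h1 := hσ (σ * τ)
    rw [hmul] at h1
    have := hζ0 σ
    have := hζ0 τ
    have := hu0 (σ * τ)
    field_simp
    refine mul_right_cancel₀ hβ' ?_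
    linear_combination -h1
  have hone : ζ (σ * τ) * (ζ σ * ζ τ)⁻¹ = 1 := by
    refine IsNearOne.eq_one hμ (hq ▸ ((hu σ).mul hy1).mul (hu _).inv) ?_
    simp only [mul_pow, inv_pow, hζ, mul_one, inv_one]
  have hfin : ζ (σ * τ) = ζ σ * ζ τ :=
    eq_of_mul_inv_eq_one hone
  exact Subtype.ext (Units.ext hfin)

/-- An automorphism fixing `β ^ ℓ` and multiplying `β` by a factor near `1` fixes `β`, since that
factor is an `ℓ`-th root of unity. -/
theorem algEquiv_eq_of_pow_eq
    (hμ : ∀ ζ : Ω, ζ ^ ℓ = 1 → ζ ≠ 1 → w (ζ - 1) ^ (ℓ - 1) = w (ℓ : Ω))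
    {L : IntermediateField K Ω} {β : L} (hβ : β ≠ 0) {σ : L ≃ₐ[K] L} (hσ : σ β ^ ℓ = β ^ ℓ)
    {u : Ω} (hu : IsNearOne w ℓ u) (h : (σ β : Ω) = β * u) : σ β = β := by
  have hβ' : (β : Ω) ≠ 0 := fun h0 => hβ (Subtype.ext h0)
  have h1 : u ^ ℓ = 1 := by
    have h2 := congrArg (fun x : L => (x : Ω)) hσ
    simp only [IntermediateField.coe_pow, h, mul_pow] at h2
    exact mul_left_cancel₀ (pow_ne_zero ℓ hβ') (by rw [h2, mul_one])
  refine Subtype.ext ?_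
  rw [h, hu.eq_one hμ h1, mul_one]

end Characters

/-! ### The fields generated by iterated preimages -/

section Level

variable {K : Type*} [Field K] {Ω : Type*} [Field Ω] [Algebra K Ω]
  {Γ : Type*} [LinearOrderedCommGroupWithZero Γ] {w : Valuation Ω Γ} {ℓ n : ℕ} {c a : K}

/-- A field containing one solution of `f^n(z) = a` contains all of them: this goes by induction on
`n`, each step being an instance of `IsNearTwist.mem`. -/
theorem level_eq_adjoin_singleton [IsAlgClosed Ω] [Algebra.IsAlgebraic K Ω] (hℓ : 2 ≤ ℓ)
    (hinv : ∀ x y : Ω, minpoly K x = minpoly K y → w x = w y)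
    (hμ : ∀ ζ : Ω, ζ ^ ℓ = 1 → ζ ≠ 1 → w (ζ - 1) ^ (ℓ - 1) = w (ℓ : Ω))
    (hK : ∀ ζ : Ω, ζ ^ ℓ = 1 → ζ ∈ Set.range (algebraMap K Ω)) (hℓΩ : (ℓ : Ω) ≠ 0)
    (hc : 1 < w (algebraMap K Ω c) ^ (ℓ - 1) * w (ℓ : Ω) ^ ℓ)
    (ha : w (algebraMap K Ω a) < w (algebraMap K Ω c)) {α : Ω}
    (hα : α ∈ preimages Ω ℓ c a n) : level Ω ℓ c a n = IntermediateField.adjoin K {α} := by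
  have hmem : ∀ (E : IntermediateField K Ω) (n : ℕ) (x y : Ω), x ∈ preimages Ω ℓ c a n →
      y ∈ preimages Ω ℓ c a n → x ∈ E → y ∈ E := by
    intro E n
    induction n with
    | zero =>
      intro x y _ hy _
      rw [mem_preimages_zero.1 hy]
      exact E.algebraMap_mem a
    | succ n ih =>
      intro x y hx hy hxE
      have hyE := ih _ _ (mem_preimages_succ.1 hx) (mem_preimages_succ.1 hy)
        (E.sub_mem (pow_mem hxE ℓ) (E.algebraMap_mem c))
      have hyℓ := E.add_mem hyE (E.algebraMap_mem c)
      rw [sub_add_cancel] at hyℓ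
      exact (isNearTwist_of_mem_preimages hℓ hμ hc ha hx hy).mem hinv hμ hK hℓΩ E hxE
        (ne_zero_of_mem_preimages_succ hℓ (one_lt_of_one_lt_pow_mul hc) ha hx) hyℓ
  refine le_antisymm ?_ ?_
  · exact IntermediateField.adjoin_le_iff.2 fun y hy =>
      hmem _ n α y hα hy (IntermediateField.mem_adjoin_simple_self K α)
  · exact IntermediateField.adjoin_le_iff.2 fun y hy => by
      rw [Set.mem_singleton_iff.1 hy]
      exact IntermediateField.subset_adjoin _ _ hα

theorem iterate_mem_preimages {z : Ω} (i m : ℕ) (hz : z ∈ preimages Ω ℓ c a (i + m)) :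
    (fun y => y ^ ℓ - algebraMap K Ω c)^[i] z ∈ preimages Ω ℓ c a m := by
  induction i generalizing z with
  | zero => simpa using hz
  | succ i ih =>
    rw [Function.iterate_succ_apply]
    refine ih (mem_preimages_succ.1 ?_)
    rwa [Nat.add_right_comm] at hz

theorem algEquiv_eq_one_of_eq_adjoin {L : IntermediateField K Ω} {z : L}
    (hL : L = IntermediateField.adjoin K {(z : Ω)}) {σ : L ≃ₐ[K] L} (hσ : σ z = z) : σ = 1 := by
  have hext := IntermediateField.algHom_ext_of_eq_adjoin K hL (φ₁ := (σ : L →ₐ[K] L))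
    (φ₂ := AlgHom.id K L) (by
      intro x hx
      obtain rfl := Set.mem_singleton_iff.1 hx
      exact hσ)
  ext x
  exact congrArg Subtype.val (DFunLike.congr_fun hext x)

/-- The forward orbit of `z` ends in `a ∈ K`; an automorphism which multiplies each of its members
by a factor near `1` fixes them all, one after the other, starting from `a`. -/
theorem algEquiv_eq_of_iterate (hℓ : 2 ≤ ℓ)
    (hμ : ∀ ζ : Ω, ζ ^ ℓ = 1 → ζ ≠ 1 → w (ζ - 1) ^ (ℓ - 1) = w (ℓ : Ω))
    (h1 : 1 < w (algebraMap K Ω c)) (ha : w (algebraMap K Ω a) < w (algebraMap K Ω c))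
    {L : IntermediateField K Ω} (σ : L ≃ₐ[K] L) {z : L}
    (hz : (z : Ω) ∈ preimages Ω ℓ c a n)
    (hσ : ∀ i < n, ∃ u, IsNearOne w ℓ u ∧
      (σ ((fun y => y ^ ℓ - algebraMap K L c)^[i] z) : Ω) =
        ((fun y => y ^ ℓ - algebraMap K L c)^[i] z : L) * u) : σ z = z := by
  induction n generalizing z with
  | zero =>
    have hz' : z = algebraMap K L a := Subtype.ext (mem_preimages_zero.1 hz)
    rw [hz', σ.commutes]
  | succ n ih =>
    have hfix := ih (z := z ^ ℓ - algebraMap K L c) (mem_preimages_succ.1 hz) fun i hi => by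
      have h := hσ (i + 1) (Nat.succ_lt_succ hi)
      rwa [Function.iterate_succ_apply] at h
    rw [map_sub, map_pow, σ.commutes, sub_left_inj] at hfix
    obtain ⟨u, hu, h⟩ := hσ 0 n.succ_pos
    refine algEquiv_eq_of_pow_eq hμ (fun h0 => ?_) hfix hu h
    exact ne_zero_of_mem_preimages_succ hℓ h1 ha hz (congrArg Subtype.val h0)

/-- The characters attached to the `n` members of the forward orbit of `α` which precede `a`
determine an automorphism of `K(α)`. -/
theorem exists_injective_hom_pi [IsAlgClosed Ω] (hℓ : 2 ≤ ℓ)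
    (hinv : ∀ x y : Ω, minpoly K x = minpoly K y → w x = w y)
    (hμ : ∀ ζ : Ω, ζ ^ ℓ = 1 → ζ ≠ 1 → w (ζ - 1) ^ (ℓ - 1) = w (ℓ : Ω))
    (hK : ∀ ζ : Ω, ζ ^ ℓ = 1 → ζ ∈ Set.range (algebraMap K Ω))
    (hc : 1 < w (algebraMap K Ω c) ^ (ℓ - 1) * w (ℓ : Ω) ^ ℓ)
    (ha : w (algebraMap K Ω a) < w (algebraMap K Ω c)) {α : Ω}
    (hα : α ∈ preimages Ω ℓ c a n) {L : IntermediateField K Ω}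
    (hL : L = IntermediateField.adjoin K {α}) :
    ∃ φ : (L ≃ₐ[K] L) →* (Fin n → rootsOfUnity ℓ Ω), Function.Injective φ := by
  have hne : NeZero ℓ := ⟨by omega⟩
  have h1 := one_lt_of_one_lt_pow_mul hc
  obtain ⟨z, rfl⟩ : ∃ z : L, (z : Ω) = α :=
    ⟨⟨α, hL ▸ IntermediateField.mem_adjoin_simple_self K α⟩, rfl⟩
  have hmem : ∀ i : Fin n, ((fun y => y ^ ℓ - algebraMap K L c)^[(i : ℕ)] z : Ω) ∈
      preimages Ω ℓ c a (n - 1 - i + 1) := by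
    intro i
    have h := iterate_mem_preimages (i : ℕ) (n - 1 - i + 1) (z := (z : Ω))
      (by rwa [show (i : ℕ) + (n - 1 - i + 1) = n by omega])
    have hsemi : Function.Semiconj (fun x : L => (x : Ω)) (fun y => y ^ ℓ - algebraMap K L c)
        (fun y => y ^ ℓ - algebraMap K Ω c) := fun _ => rfl
    have hit := hsemi.iterate_right i z
    rwa [← hit] at h
  have hchar := fun i : Fin n => exists_character hinv hμ hK (L := L)
    (fun h0 => ne_zero_of_mem_preimages_succ hℓ h1 ha (hmem i) (congrArg Subtype.val h0))
    fun σ => isNearTwist_of_mem_preimages hℓ hμ hc ha (hmem i)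
      (algEquiv_mem_preimages L.val σ (hmem i))
  choose χ hχ using hchar
  refine ⟨MonoidHom.pi χ, (injective_iff_map_eq_one _).2 fun σ hσ => ?_⟩
  have hfix : σ z = z := by
    refine algEquiv_eq_of_iterate hℓ hμ h1 ha σ hα fun i hi => ?_
    obtain ⟨u, hu, h⟩ := hχ ⟨i, hi⟩ σ
    have hone : χ ⟨i, hi⟩ σ = 1 := congrFun hσ ⟨i, hi⟩
    refine ⟨u, hu, ?_⟩
    rw [h, hone]
    simp
  exact algEquiv_eq_one_of_eq_adjoin hL hfix

/-- When `ℓ` is a unit, all members of the tree are near twists of one `ℓ`-th root `γ` of `c`.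
For `n ≥ 1` this makes `K(α) = K(γ)`, a Kummer extension of degree dividing `ℓ`. -/
theorem exists_injective_hom_rootsOfUnity_of_unit [IsAlgClosed Ω] [Algebra.IsAlgebraic K Ω]
    (hℓ : 2 ≤ ℓ)
    (hinv : ∀ x y : Ω, minpoly K x = minpoly K y → w x = w y)
    (hμ : ∀ ζ : Ω, ζ ^ ℓ = 1 → ζ ≠ 1 → w (ζ - 1) ^ (ℓ - 1) = w (ℓ : Ω))
    (hK : ∀ ζ : Ω, ζ ^ ℓ = 1 → ζ ∈ Set.range (algebraMap K Ω)) (hwℓ : w (ℓ : Ω) = 1)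
    (h1 : 1 < w (algebraMap K Ω c)) (ha : w (algebraMap K Ω a) < w (algebraMap K Ω c))
    {α : Ω} (hα : α ∈ preimages Ω ℓ c a n) {L : IntermediateField K Ω}
    (hL : L = IntermediateField.adjoin K {α}) :
    ∃ φ : (L ≃ₐ[K] L) →* rootsOfUnity ℓ Ω, Function.Injective φ := by
  have hne : NeZero ℓ := ⟨by omega⟩
  have hℓΩ : (ℓ : Ω) ≠ 0 := fun h0 => by simp [h0] at hwℓ
  have hαL : α ∈ L := hL ▸ IntermediateField.mem_adjoin_simple_self K α
  rcases n with _ | n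
  · refine ⟨1, fun σ τ _ => ?_⟩
    have hbot : L = ⊥ := by
      rw [hL, mem_preimages_zero.1 hα, IntermediateField.adjoin_simple_eq_bot_iff]
      exact IntermediateField.algebraMap_mem _ a
    subst hbot
    ext x
    obtain ⟨y, hy⟩ := IntermediateField.mem_bot.1 x.2
    have hx : x = algebraMap K _ y := Subtype.ext hy.symm
    rw [hx, σ.commutes, τ.commutes]
  obtain ⟨γ, hγ⟩ := IsAlgClosed.exists_pow_nat_eq (algebraMap K Ω c) (n := ℓ) (by omega)
  have hγ0 : γ ≠ 0 := by
    rintro rfl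
    rw [zero_pow (by omega)] at hγ
    rw [← hγ, map_zero] at h1
    exact not_lt_zero h1
  have htw : ∀ {m : ℕ} {z : Ω}, z ∈ preimages Ω ℓ c a (m + 1) → IsNearTwist w ℓ γ z := by
    intro m z hz
    refine IsNearTwist.of_pow (by omega) hγ0 ?_
    rw [hγ, hwℓ, one_pow, mul_one]
    exact pow_lt_pow_left₀ (map_lt_of_mem_preimages hℓ h1 ha (mem_preimages_succ.1 hz))
      zero_le (by omega)
  have hγL : γ ∈ L := (htw hα).symm (by omega) |>.mem hinv hμ hK hℓΩ L hαL
    (ne_zero_of_mem_preimages_succ hℓ h1 ha hα) (hγ ▸ L.algebraMap_mem c)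
  have hmem : ∀ (m : ℕ) (z : Ω), z ∈ preimages Ω ℓ c a m →
      z ∈ IntermediateField.adjoin K {γ} := by
    intro m
    induction m with
    | zero =>
      intro z hz
      rw [mem_preimages_zero.1 hz]
      exact IntermediateField.algebraMap_mem _ a
    | succ m ih =>
      intro z hz
      refine (htw hz).mem hinv hμ hK hℓΩ _ (IntermediateField.mem_adjoin_simple_self K γ) hγ0 ?_
      have h := add_mem (ih _ (mem_preimages_succ.1 hz)) (IntermediateField.algebraMap_mem _ c)
      rwa [sub_add_cancel] at h
  have hLγ : L = IntermediateField.adjoin K {γ} := by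
    refine le_antisymm ?_ ?_
    · rw [hL, IntermediateField.adjoin_simple_le_iff]
      exact hmem _ _ hα
    · rwa [IntermediateField.adjoin_simple_le_iff]
  obtain ⟨g, rfl⟩ : ∃ g : L, (g : Ω) = γ := ⟨⟨γ, hγL⟩, rfl⟩
  have hg0 : g ≠ 0 := fun h0 => hγ0 (congrArg Subtype.val h0)
  have hgℓ : g ^ ℓ = algebraMap K L c := Subtype.ext hγ
  have hσg : ∀ σ : L ≃ₐ[K] L, σ g ^ ℓ = g ^ ℓ := fun σ => by
    rw [← map_pow, hgℓ, σ.commutes]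
  obtain ⟨χ, hχ⟩ := exists_character hinv hμ hK hg0 fun σ => by
    refine IsNearTwist.of_pow (by omega) hγ0 ?_
    have h2 : (σ g : Ω) ^ ℓ = (g : Ω) ^ ℓ := congrArg Subtype.val (hσg σ)
    rw [h2, sub_self, map_zero, zero_pow (by omega), hγ, hwℓ, one_pow, mul_one]
    exact pow_pos (zero_lt_one.trans h1) _
  refine ⟨χ, (injective_iff_map_eq_one _).2 fun σ hσ => ?_⟩
  obtain ⟨u, hu, h⟩ := hχ σ
  have hfix := algEquiv_eq_of_pow_eq hμ hg0 (hσg σ) hu (by rw [h, hσ]; simp)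
  exact algEquiv_eq_one_of_eq_adjoin hLγ hfix

end Level

/-! ### The hypotheses in multiplicative form -/

section OrderConversion

variable {K : Type*} [Field K] [Valued K ℤᵐ⁰] {ℓ : ℕ} {c : K}

/-- The additive bound on `v(c)`, cleared of denominators and written multiplicatively. -/
theorem one_lt_pow_mul_pow_of_ord_lt (hℓ : 2 ≤ ℓ) (hℓK : (ℓ : K) ≠ 0) (hc0 : c ≠ 0)
    (hc : (ord c : ℝ) < -((ℓ : ℝ) / ((ℓ : ℝ) - 1) * (ord (ℓ : K) : ℝ))) :
    1 < (Valued.v (c ^ (ℓ - 1) * (ℓ : K) ^ ℓ) : ℤᵐ⁰) := by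
  have hvc : (Valued.v c : ℤᵐ⁰) ≠ 0 := (Valuation.ne_zero_iff _).2 hc0
  have hvℓ : (Valued.v (ℓ : K) : ℤᵐ⁰) ≠ 0 := (Valuation.ne_zero_iff _).2 hℓK
  have hv := mul_ne_zero (pow_ne_zero (ℓ - 1) hvc) (pow_ne_zero ℓ hvℓ)
  rw [map_mul, map_pow, map_pow, ← WithZero.exp_zero, ← WithZero.lt_log_iff_exp_lt hv,
    WithZero.log_mul (pow_ne_zero _ hvc) (pow_ne_zero _ hvℓ), WithZero.log_pow, WithZero.log_pow]
  have hpos : (0 : ℝ) < (ℓ : ℝ) - 1 := by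
    have : (2 : ℝ) ≤ ℓ := by exact_mod_cast hℓ
    linarith
  have hmul := mul_lt_mul_of_pos_left hc hpos
  rw [mul_neg, ← mul_assoc, mul_div_cancel₀ _ hpos.ne'] at hmul
  simp only [ord, Int.cast_neg] at hmul
  have hcast : ((ℓ - 1 : ℕ) : ℝ) = (ℓ : ℝ) - 1 := by rw [Nat.cast_sub (by omega), Nat.cast_one]
  have hreal : (0 : ℝ) < ((ℓ - 1 : ℕ) : ℝ) * ((WithZero.log (Valued.v c : ℤᵐ⁰) : ℤ) : ℝ) +
      (ℓ : ℝ) * ((WithZero.log (Valued.v (ℓ : K) : ℤᵐ⁰) : ℤ) : ℝ) := by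
    rw [hcast]; linarith
  simp only [nsmul_eq_mul]
  exact_mod_cast hreal

theorem map_lt_map_of_ord_lt {a : K} (hc0 : c ≠ 0) (ha : a = 0 ∨ ord c < ord a) :
    (Valued.v a : ℤᵐ⁰) < Valued.v c := by
  have hvc : (Valued.v c : ℤᵐ⁰) ≠ 0 := (Valuation.ne_zero_iff _).2 hc0
  rcases eq_or_ne a 0 with rfl | ha0
  · rw [map_zero]
    exact zero_lt_iff.2 hvc
  · have hva : (Valued.v a : ℤᵐ⁰) ≠ 0 := (Valuation.ne_zero_iff _).2 ha0
    rw [← WithZero.log_lt_log hva hvc]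
    exact neg_lt_neg_iff.1 (ha.resolve_left ha0)

theorem map_natCast_eq_one_of_not_dvd (p : ℕ) [CharP 𝓀[K] p] (h : ¬ p ∣ ℓ) :
    (Valued.v (ℓ : K) : ℤᵐ⁰) = 1 := by
  have hres : IsLocalRing.residue 𝒪[K] (ℓ : 𝒪[K]) ≠ 0 := by
    rw [map_natCast]
    exact fun h0 => h ((CharP.cast_eq_zero_iff 𝓀[K] p ℓ).1 h0)
  have hunit := (IsLocalRing.residue_ne_zero_iff_isUnit _).1 hres
  have h1 := (Valuation.integer.integers (Valued.v : Valuation K ℤᵐ⁰)).isUnit_iff_valuation_eq_one.1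
    hunit
  simpa using h1

end OrderConversion

theorem isCyclic_quotient_and_card_dvd {G H : Type*} [Group G] [Group H] [IsCyclic H] {ℓ : ℕ}
    (hH : Nat.card H = ℓ) (φ : G →* H) (hφ : Function.Injective φ) (N : Subgroup G) [N.Normal] :
    IsCyclic (G ⧸ N) ∧ Nat.card (G ⧸ N) ∣ ℓ := by
  have : IsCyclic G := isCyclic_of_injective φ hφ
  refine ⟨isCyclic_of_surjective (QuotientGroup.mk' N) (QuotientGroup.mk'_surjective N), ?_⟩
  exact (Subgroup.card_quotient_dvd_card N).trans (hH ▸ Subgroup.card_dvd_of_injective φ hφ)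

end LocalArboreal

theorem theorem4p2
    {K : Type*} [Field K] [Valued K ℤᵐ⁰] [CompleteSpace K]
    [(Valued.v : Valuation K ℤᵐ⁰).IsRankOneDiscrete]
    (p : ℕ) [CharP 𝓀[K] p]
    {Ω : Type*} [Field Ω] [Algebra K Ω] [IsAlgClosure K Ω]
    (ℓ : ℕ) (hℓ : 2 ≤ ℓ)
    (hcase : ¬ p ∣ ℓ ∨ (ℓ = p ∧ LocalArboreal.IsFinitePadicExtension p K))
    (c a : K) (hc0 : c ≠ 0)
    (hc : (LocalArboreal.ord c : ℝ) <
      -((ℓ : ℝ) / ((ℓ : ℝ) - 1) * (LocalArboreal.ord (ℓ : K) : ℝ)))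
    -- the additive valuation of `a` (possibly infinite) exceeds that of `c`
    (ha : a = 0 ∨ LocalArboreal.ord c < LocalArboreal.ord a)
    (hμ : ∀ ζ : Ω, ζ ^ ℓ = 1 → ζ ∈ Set.range (algebraMap K Ω))
    (n : ℕ) :
    (∃ φ : (LocalArboreal.level Ω ℓ c a n ≃ₐ[K] LocalArboreal.level Ω ℓ c a n) →*
        Multiplicative (Fin n → ZMod ℓ), Function.Injective φ) ∧
    (IsCyclic ((LocalArboreal.level Ω ℓ c a n ≃ₐ[K] LocalArboreal.level Ω ℓ c a n) ⧸
        LocalArboreal.inertia K (LocalArboreal.level Ω ℓ c a n)) ∧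
      Nat.card ((LocalArboreal.level Ω ℓ c a n ≃ₐ[K] LocalArboreal.level Ω ℓ c a n) ⧸
        LocalArboreal.inertia K (LocalArboreal.level Ω ℓ c a n)) ∣ ℓ) ∧
    (∀ α ∈ LocalArboreal.preimages Ω ℓ c a n,
      LocalArboreal.level Ω ℓ c a n = IntermediateField.adjoin K {α}) := by
  open LocalArboreal in
  have hclosed : IsAlgClosed Ω := IsAlgClosure.isAlgClosed K
  have halg : Algebra.IsAlgebraic K Ω := IsAlgClosure.isAlgebraic
  obtain ⟨w, hle, hinv, -⟩ := exists_valuation_extension K Ω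
  have hlt : ∀ x y : K, (Valued.v x : ℤᵐ⁰) < Valued.v y →
      w (algebraMap K Ω x) < w (algebraMap K Ω y) := fun x y h => by
    rw [← not_le, hle, not_le]; exact h
  have hℓK : (ℓ : K) ≠ 0 := by
    rcases hcase with h | ⟨-, h⟩
    · intro h0
      have h1 := map_natCast_eq_one_of_not_dvd (K := K) p h
      rw [h0, map_zero] at h1
      exact zero_ne_one h1
    · have := h.charZero
      exact Nat.cast_ne_zero.2 (by omega)
  have hℓΩ : (ℓ : Ω) ≠ 0 := fun h0 => hℓK ((algebraMap K Ω).injective (by simpa using h0))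
  have hcw : 1 < w (algebraMap K Ω c) ^ (ℓ - 1) * w (ℓ : Ω) ^ ℓ := by
    have h := hlt 1 (c ^ (ℓ - 1) * (ℓ : K) ^ ℓ) (by
      rw [map_one]; exact one_lt_pow_mul_pow_of_ord_lt hℓ hℓK hc0 hc)
    simpa using h
  have haw : w (algebraMap K Ω a) < w (algebraMap K Ω c) := hlt _ _ (map_lt_map_of_ord_lt hc0 ha)
  -- `w` and `Valued.v` take values in different groups, so `w ℓ = 1` is two inequalities.
  have hwtame : ¬ p ∣ ℓ → w (ℓ : Ω) = 1 := fun h => by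
    have h1 := map_natCast_eq_one_of_not_dvd (K := K) p h
    have h2 := (hle (ℓ : K) 1).2 (by rw [h1, map_one])
    have h3 := (hle 1 (ℓ : K)).2 (by rw [h1, map_one])
    simp only [map_natCast, map_one] at h2 h3
    exact le_antisymm h2 h3
  have hμw : ∀ ζ : Ω, ζ ^ ℓ = 1 → ζ ≠ 1 → w (ζ - 1) ^ (ℓ - 1) = w (ℓ : Ω) := by
    intro ζ hζ h1
    rcases hcase with h | ⟨h, hp, -⟩
    · exact map_sub_one_pow_of_unit w (by omega) (hwtame h) hζ h1
    · exact map_sub_one_pow_of_prime w (h ▸ hp.out) hζ h1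
  have hlevel : ∀ α ∈ preimages Ω ℓ c a n, level Ω ℓ c a n = IntermediateField.adjoin K {α} :=
    fun α hα => level_eq_adjoin_singleton hℓ hinv hμw hμ hℓΩ hcw haw hα
  obtain ⟨α, hα⟩ := preimages_nonempty (Ω := Ω) (ℓ := ℓ) (c := c) (a := a) (n := n)
    (by omega)
  have hne : NeZero (ℓ : Ω) := ⟨hℓΩ⟩
  have hne0 : NeZero ℓ := ⟨by omega⟩
  have hcard : Nat.card (rootsOfUnity ℓ Ω) = ℓ := HasEnoughRootsOfUnity.natCard_rootsOfUnity Ω ℓ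
  obtain ⟨φ, hφ⟩ := exists_injective_hom_pi hℓ hinv hμw hμ hcw haw hα (hlevel α hα)
  refine ⟨?_, ?_, hlevel⟩
  -- `Ω` contains exactly `ℓ` roots of unity, because `ℓ ≠ 0` in `Ω`.
  · let e : rootsOfUnity ℓ Ω ≃* Multiplicative (ZMod ℓ) :=
      ((AddEquiv.toMultiplicative (ZMod.ringEquivCongr hcard).toAddEquiv).symm.trans
        (zmodCyclicMulEquiv inferInstance)).symm
    let E : (Fin n → rootsOfUnity ℓ Ω) ≃* Multiplicative (Fin n → ZMod ℓ) :=
      (MulEquiv.piCongrRight fun _ => e).trans (MulEquiv.piMultiplicative fun _ => ZMod ℓ).symm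
    exact ⟨E.toMonoidHom.comp φ, E.injective.comp hφ⟩
  · rcases hcase with h | ⟨rfl, h⟩
    · obtain ⟨ψ, hψ⟩ := exists_injective_hom_rootsOfUnity_of_unit hℓ hinv hμw hμ (hwtame h)
        (one_lt_of_one_lt_pow_mul hcw) haw hα (hlevel α hα)
      exact isCyclic_quotient_and_card_dvd hcard ψ hψ _
    · obtain ⟨hdvr, hfin⟩ := h.isDiscreteValuationRing_and_finite
      have := h.charZero
      have hfd : FiniteDimensional K (level Ω ℓ c a n) := by
        rw [hlevel α hα]
        exact IntermediateField.adjoin.finiteDimensional (Algebra.IsIntegral.isIntegral α)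
      -- The order of a cyclic group is its exponent, which divides `ℓ` as `φ` is injective.
      have hcyc := isCyclic_quotient_inertia K (level Ω ℓ c a n)
      refine ⟨hcyc, ?_⟩
      rw [← IsCyclic.exponent_eq_card, Monoid.exponent_dvd_iff_forall_pow_eq_one]
      intro g
      obtain ⟨σ, rfl⟩ := QuotientGroup.mk_surjective g
      have hσ : σ ^ ℓ = 1 := hφ (by
        rw [map_pow, map_one]
        exact funext fun i => Subtype.ext ((φ σ i).2))
      rw [← QuotientGroup.mk_pow, hσ, QuotientGroup.mk_one]
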